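/- Let $\mathbb F$ be a field of characteristic different from $2$ and $3$. Let $(\mathcal A,{}^-)$ be a structurable algebra over $\mathbb F$ (of arbitrary dimension): a unital, not necessarily associative $\mathbb F$-algebra with an involution ${}^-$ (an $\mathbb F$-linear map with $\overline{\bar x}=x$ and $\overline{xy}=\bar y\,\bar x$) such that the operators $$V_{x,y}(z)=(x\bar y)z+(z\bar y)x-(z\bar x)y$$ satisfy $[V_{x,y},V_{z,w}]=V_{V_{x,y}(z),w}-V_{z,V_{y,x}(w)}$ for all $x,y,z,w\in\mathcal A$. Let $\mathcal S=\{a\in\mathcal A\mid \bar a=-a\}$, and let $s\in\mathcal S$ be such that the left multiplication $L_s\colon x\mapsto sx$ is bijective. Then the formulas $$a\cdot b=\tfrac12\bigl(a(sb)+b(sa)\bigr),\qquad a\bullet x=a(sx),\qquad \langle x\mid y\rangle=x\bar y-y\bar x,\qquad \{x,y,z\}=-V_{x,sy}(z)$$ for $a,b\in\mathcal S$, $x,y,z\in\mathcal A$, define multilinear maps $\mathcal S\times\mathcal S\to\mathcal S$, $\mathcal S\times\mathcal A\to\mathcal A$, $\mathcal A\times\mathcal A\to\mathcal S$ and $\mathcal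 A\times\mathcal A\times\mathcal A\to\mathcal A$, and with them $(\mathcal J,\mathcal T)=(\mathcal S,\mathcal A)$ is a $J$-ternary algebra. That is: * $(\mathcal J,\cdot)$ is a unital Jordan algebra: $a\cdot b=b\cdot a$, $(a\cdot b)\cdot(a\cdot a)=a\cdot(b\cdot(a\cdot a))$, and there is $e\in\mathcal J$ with $e\cdot a=a$ for all $a$; * $\mathcal T$ is a unital special Jordan module: $(a\cdot b)\bullet x=\frac12\bigl(a\bullet(b\bullet x)+b\bullet(a\bullet x)\bigr)$ and $e\bullet x=x$; * $\langle x\mid y\rangle=-\langle y\mid x\rangle$; * for all $a\in\mathcal J$ and $x,y,z,w,v\in\mathcal T$: - (JT1) $a\cdot\langle x\mid y\rangle=\frac12\bigl(\langle a\bullet x\mid y\rangle+\langle x\mid a\bullet y\rangle\bigr)$, - (JT2) $a\bullet\{x,y,z\}=\{a\bullet x,y,z\}-\{x,a\bullet y,z\}+\{x,y,a\bullet z\}$, - (JT3) $\{x,y,z\}=\{z,y,x\}-\langle x\mid z\rangle\bullet y$, - (JT4) $\{x,y,z\}=\{y,x,z\}+\langle x\mid y\rangle\bullet z$, - (JT5)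 $\langle\{x,y,z\}\mid w\rangle+\langle z\mid\{x,y,w\}\rangle=\langle x\mid\langle z\mid w\rangle\bullet y\rangle$, - (JT6) $\{x,y,\{z,w,v\}\}=\{\{x,y,z\},w,v\}+\{z,\{y,x,w\},v\}+\{z,w,\{x,y,v\}\}$. -/

import Mathlib

/-- The operator `V_{x,y}(z) = (x ȳ) z + (z ȳ) x - (z x̄) y` on a not necessarily associative
algebra `A` over `F` with a linear map `σ : x ↦ x̄`. -/
def vOp {F A : Type*} [Field F] [NonAssocRing A] [Module F A] [IsScalarTower F A A]
    [SMulCommClass F A A] (σ : A →ₗ[F] A) (x y : A) : Module.End F A where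
  toFun z := (x * σ y) * z + (z * σ y) * x - (z * σ x) * y
  map_add' z w := by simp only [mul_add, add_mul]; abel
  map_smul' c z := by
    simp only [mul_smul_comm, smul_mul_assoc, RingHom.id_apply, smul_add, smul_sub]

/-- `(A, σ)` is a structurable algebra over `F`: `σ` is an involution of the unital algebra `A`
(an `F`-linear anti-automorphism of period at most two), and the operators `V_{x,y}` satisfy
`[V_{x,y}, V_{z,w}] = V_{V_{x,y}(z), w} - V_{z, V_{y,x}(w)}`. -/
structure IsStructurable {F A : Type*} [Field F] [NonAssocRing A] [Module F A]
    [IsScalarTower F A A] [SMulCommClass F A A] (σ : A →ₗ[F] A) : Prop where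
  invol : ∀ x, σ (σ x) = x
  anti : ∀ x y, σ (x * y) = σ y * σ x
  comm_vOp : ∀ x y z w,
    ⁅vOp σ x y, vOp σ z w⁆ = vOp σ (vOp σ x y z) w - vOp σ z (vOp σ y x w)

/-- The subspace of skew-symmetric elements, `s̄ = -s`. -/
def skewElements {F A : Type*} [Field F] [NonAssocRing A] [Module F A] (σ : A →ₗ[F] A) :
    Submodule F A where
  carrier := {a | σ a = -a}
  add_mem' {a b} ha hb := by
    simp only [Set.mem_ofPred_eq] at ha hb ⊢
    rw [map_add, ha, hb, neg_add]
  zero_mem' := by simp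
  smul_mem' c a ha := by
    simp only [Set.mem_ofPred_eq] at ha ⊢
    rw [map_smul, ha, smul_neg]

/-- A bilinear product `mul` on the `F`-vector space `J` with identity element `e`
makes `J` a (linear) unital Jordan algebra. -/
structure IsUnitalJordan {F J : Type*} [Field F] [AddCommGroup J] [Module F J]
    (mul : J →ₗ[F] J →ₗ[F] J) (e : J) : Prop where
  comm : ∀ a b, mul a b = mul b a
  jordan : ∀ a b, mul (mul a b) (mul a a) = mul a (mul b (mul a a))
  one_mul : ∀ a, mul e a = a

/-- A bilinear action `act` of the Jordan algebra `(J, mul)` with identity element `e` on `T`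
makes `T` a unital special Jordan module, i.e. `a ↦ act a` is a unital homomorphism of Jordan
algebras into `End(T)` with the product `(f g + g f) / 2`. -/
structure IsUnitalSpecialModule {F J T : Type*} [Field F] [AddCommGroup J] [Module F J]
    [AddCommGroup T] [Module F T] (mul : J →ₗ[F] J →ₗ[F] J) (e : J)
    (act : J →ₗ[F] T →ₗ[F] T) : Prop where
  act_mul : ∀ a b x, act (mul a b) x = (2⁻¹ : F) • (act a (act b x) + act b (act a x))
  act_one : ∀ x, act e x = x

/-- `(J, T)` is a `J`-ternary algebra with Jordan product `mul a b = a · b`, action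
`act a x = a • x`, bilinear map `form x y = ⟨x | y⟩` and triple product
`tri x y z = {x, y, z}`. -/
structure IsJTernary {F J T : Type*} [Field F] [AddCommGroup J] [Module F J]
    [AddCommGroup T] [Module F T] (mul : J →ₗ[F] J →ₗ[F] J) (act : J →ₗ[F] T →ₗ[F] T)
    (form : T →ₗ[F] T →ₗ[F] J) (tri : T →ₗ[F] T →ₗ[F] T →ₗ[F] T) : Prop where
  exists_one : ∃ e : J, IsUnitalJordan mul e ∧ IsUnitalSpecialModule mul e act
  form_skew : ∀ x y, form x y = -form y x
  jt1 : ∀ a x y, mul a (form x y) = (2⁻¹ : F) • (form (act a x) y + form x (act a y))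
  jt2 : ∀ a x y z,
    act a (tri x y z) = tri (act a x) y z - tri x (act a y) z + tri x y (act a z)
  jt3 : ∀ x y z, tri x y z = tri z y x - act (form x z) y
  jt4 : ∀ x y z, tri x y z = tri y x z + act (form x y) z
  jt5 : ∀ x y z w, form (tri x y z) w + form z (tri x y w) = form x (act (form z w) y)
  jt6 : ∀ x y z w v, tri x y (tri z w v) =
    tri (tri x y z) w v + tri z (tri y x w) v + tri z w (tri x y v)

/-! Write ψ for `skewForm`. Since ψ(x,z)y = V_{x,y}z - V_{z,y}x, the commutator identity controls
every L_{ψ(x,z)}, and ψ(s,1) = 2s extends this to L_s for all skew s. This yields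
skew-alternativity, and from it three exchange rules between V and L_s: `vOp_skew_mul`,
`vOp_mul_left_sub`, `vOp_mul_right_sub`.

(JT3) is the formula for ψ(x,z)y, (JT4) the third rule, (JT5) the first rule evaluated at 1; (JT1)
and (JT2) combine the rules, and (JT6) is the commutator identity with L_s moved across. The Jordan
axioms are pulled back along a ↦ L_a L_s, which is injective and a Jordan homomorphism into End(A)
by `skew_triple_mul`. -/

theorem vOp_apply {F A : Type*} [Field F] [NonAssocRing A] [Module F A] [IsScalarTower F A A]
    [SMulCommClass F A A] (σ : A →ₗ[F] A) (x y z : A) :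
    vOp σ x y z = (x * σ y) * z + (z * σ y) * x - (z * σ x) * y := rfl

/-- The skew-hermitian form `ψ(x, y) = x ȳ - y x̄`. -/
def skewForm {F A : Type*} [Field F] [NonAssocRing A] [Module F A] (σ : A →ₗ[F] A)
    (x y : A) : A := x * σ y - y * σ x

theorem mem_skewElements {F A : Type*} [Field F] [NonAssocRing A] [Module F A]
    {σ : A →ₗ[F] A} {a : A} : a ∈ skewElements σ ↔ σ a = -a := Iff.rfl

/-- The Jordan identity for the product `(f g + g f) / 2`, up to the factor `8`. -/
theorem symm_mul_jordan {R : Type*} [Ring R] (f g : R) :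
    (f * g + g * f) * (f * f + f * f) + (f * f + f * f) * (f * g + g * f) =
      f * (g * (f * f + f * f) + (f * f + f * f) * g) +
        (g * (f * f + f * f) + (f * f + f * f) * g) * f := by
  noncomm_ring

namespace IsStructurable

variable {F A : Type*} [Field F] [NonAssocRing A] [Module F A] [IsScalarTower F A A]
  [SMulCommClass F A A] {σ : A →ₗ[F] A}

/-! ### The skew form and first consequences of the commutator identity. -/

theorem map_one (hA : IsStructurable σ) : σ 1 = 1 := by
  have h := hA.anti (σ 1) 1
  rwa [mul_one, hA.invol, mul_one, eq_comm] at h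

theorem vOp_vOp (hA : IsStructurable σ) (x y z w v : A) :
    vOp σ x y (vOp σ z w v) - vOp σ z w (vOp σ x y v) =
      vOp σ (vOp σ x y z) w v - vOp σ z (vOp σ y x w) v := by
  have h := congrArg (fun f : Module.End F A => f v) (hA.comm_vOp x y z w)
  simpa [Ring.lie_def] using h

theorem skewForm_mul (_ : IsStructurable σ) (x y z : A) :
    skewForm σ x z * y = vOp σ x y z - vOp σ z y x := by
  simp only [skewForm, vOp_apply, sub_mul]; abel

theorem skewForm_swap (_ : IsStructurable σ) (x y : A) :
    skewForm σ x y = -skewForm σ y x := by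
  simp only [skewForm]; abel

theorem skewForm_mem (hA : IsStructurable σ) (x y : A) : skewForm σ x y ∈ skewElements σ := by
  rw [mem_skewElements]
  simp only [skewForm, map_sub, hA.anti, hA.invol]; abel

/-- Every skew element is thus half a value of the form, so identities for values of the form pass
to all skew elements. -/
theorem skewForm_one (hA : IsStructurable σ) {s : A} (hs : s ∈ skewElements σ) :
    skewForm σ s 1 = (2 : F) • s := by
  rw [skewForm, hA.map_one, mem_skewElements.1 hs]
  simp [two_smul]

/-- In V_{z,v}u - V_{u,v}z the vector v sits in the second slot, where V_{x,y} acts as -V_{y,x}. -/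
theorem vOp_skewForm_mul (hA : IsStructurable σ) (x y z u v : A) :
    vOp σ x y (skewForm σ z u * v) + skewForm σ z u * vOp σ y x v =
      (skewForm σ (vOp σ x y z) u + skewForm σ z (vOp σ x y u)) * v := by
  simp only [add_mul, hA.skewForm_mul, map_sub]
  linear_combination (norm := abel) hA.vOp_vOp x y z v u - hA.vOp_vOp x y u v z

theorem vOp_skew_mul_aux (hA : IsStructurable σ) (h2 : (2 : F) ≠ 0) {s : A}
    (hs : s ∈ skewElements σ) (x y v : A) :
    vOp σ x y (s * v) + s * vOp σ y x v = (vOp σ x y s + s * vOp σ y x 1) * v := by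
  have h := hA.vOp_skewForm_mul x y s 1
  -- The operator is a left multiplication, hence determined by its value at 1.
  have h1 := h 1
  simp only [mul_one] at h1
  have hv := h v
  rw [← h1, hA.skewForm_one hs] at hv
  simp only [smul_mul_assoc, map_smul, ← smul_add] at hv
  exact smul_right_injective A h2 hv

/-! ### Skew-alternativity. -/

theorem associator_aux (hA : IsStructurable σ) (h2 : (2 : F) ≠ 0) {s : A}
    (hs : s ∈ skewElements σ) (x z : A) :
    associator x s z + associator s (σ x) z = associator s z (x - σ x) := by
  have h := hA.vOp_skew_mul_aux h2 hs x 1 z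
  simp only [vOp_apply, hA.map_one, mul_one, one_mul, mul_add, mul_sub, add_mul, sub_mul] at h
  simp only [associator, mul_sub]
  linear_combination (norm := abel) -h

theorem map_associator (hA : IsStructurable σ) (x y z : A) :
    σ (associator x y z) = -associator (σ z) (σ y) (σ x) := by
  simp only [associator, map_sub, hA.anti]; abel

theorem associator_hermitian (hA : IsStructurable σ) (h2 : (2 : F) ≠ 0) {s h : A}
    (hs : s ∈ skewElements σ) (hh : σ h = h) (z : A) :
    associator h s z + associator s h z = 0 := by
  have := hA.associator_aux h2 hs h z
  rw [hh] at this
  rw [this]; simp [associator]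

theorem associator_right_hermitian (hA : IsStructurable σ) (h2 : (2 : F) ≠ 0) {s h : A}
    (hs : s ∈ skewElements σ) (hh : σ h = h) (z : A) :
    associator z s h + associator z h s = 0 := by
  have := congrArg σ (hA.associator_hermitian h2 hs hh (σ z))
  simp only [map_add, hA.map_associator, hh, hA.invol, mem_skewElements.1 hs, map_zero] at this
  simp only [associator, mul_neg, neg_mul] at this ⊢
  linear_combination (norm := abel) this

theorem associator_two_skew (hA : IsStructurable σ) (h2 : (2 : F) ≠ 0) {s t : A}
    (hs : s ∈ skewElements σ) (ht : t ∈ skewElements σ) (z : A) :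
    associator t s z - associator s t z = (2 : F) • associator s z t := by
  have := hA.associator_aux h2 hs t z
  simp only [associator, mem_skewElements.1 ht, mul_neg, neg_mul, mul_sub] at this ⊢
  linear_combination (norm := module) this

theorem associator_skew_swap_ends (hA : IsStructurable σ) (h2 : (2 : F) ≠ 0) {s t : A}
    (hs : s ∈ skewElements σ) (ht : t ∈ skewElements σ) (z : A) :
    associator s z t = -associator t z s := by
  have h := hA.associator_two_skew h2 hs ht z
  have h' := hA.associator_two_skew h2 ht hs z
  apply smul_right_injective A h2
  linear_combination (norm := module) -h - h'

theorem associator_skew_skew_hermitian (hA : IsStructurable σ) (h2 : (2 : F) ≠ 0) {s t h : A}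
    (hs : s ∈ skewElements σ) (ht : t ∈ skewElements σ) (hh : σ h = h) :
    associator s t h = -associator t s h := by
  linear_combination (norm := module)
    hA.associator_right_hermitian h2 ht hh s + hA.associator_right_hermitian h2 hs hh t
      - hA.associator_skew_swap_ends h2 hs ht h

/-- Swapping ends leaves three associators up to sign; two instances of `associator_two_skew` then
kill 3((s,t,r) + (t,s,r)). This is the only division by 3. -/
theorem associator_three_skew (hA : IsStructurable σ) (h2 : (2 : F) ≠ 0) (h3 : (3 : F) ≠ 0)
    {s t r : A} (hs : s ∈ skewElements σ) (ht : t ∈ skewElements σ) (hr : r ∈ skewElements σ) :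
    associator s t r = -associator t s r := by
  apply smul_right_injective A h3
  linear_combination (norm := module)
    -hA.associator_two_skew h2 hs ht r - (2 : F) • hA.associator_two_skew h2 ht hr s
      + (2 : F) • hA.associator_skew_swap_ends h2 hs hr t
      - (2 : F) • hA.associator_skew_swap_ends h2 hs ht r

theorem associator_skew_left (hA : IsStructurable σ) (h2 : (2 : F) ≠ 0) (h3 : (3 : F) ≠ 0)
    {s : A} (hs : s ∈ skewElements σ) (x y : A) :
    associator s x y = -associator x s y := by
  have herm (x : A) : σ (x + σ x) = x + σ x := by rw [map_add, hA.invol, add_comm]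
  have skew (x : A) : x - σ x ∈ skewElements σ := by
    rw [mem_skewElements, map_sub, hA.invol, neg_sub]
  have key {t : A} (ht : t ∈ skewElements σ) : associator s t y = -associator t s y := by
    have e1 := hA.associator_skew_skew_hermitian h2 hs ht (herm y)
    have e2 := hA.associator_three_skew h2 h3 hs ht (skew y)
    apply smul_right_injective A h2
    simp only [associator, mul_add, mul_sub] at e1 e2 ⊢
    linear_combination (norm := module) e1 + e2
  -- Twice x is the sum of its hermitian and skew parts; `key` splits y in the same way.
  have e1 := hA.associator_hermitian h2 hs (herm x) y
  have e2 := key (skew x)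
  apply smul_right_injective A h2
  simp only [associator, mul_add, mul_sub, add_mul, sub_mul] at e1 e2 ⊢
  linear_combination (norm := module) e1 + e2

theorem associator_skew_right (hA : IsStructurable σ) (h2 : (2 : F) ≠ 0) (h3 : (3 : F) ≠ 0)
    {s : A} (hs : s ∈ skewElements σ) (x y : A) :
    associator x s y = -associator x y s := by
  have := congrArg σ (hA.associator_skew_left h2 h3 hs (σ y) (σ x))
  simp only [map_neg, hA.map_associator, hA.invol, mem_skewElements.1 hs] at this
  simp only [associator, mul_neg, neg_mul] at this ⊢
  linear_combination (norm := abel) this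

theorem associator_symm_conj (hA : IsStructurable σ) (h2 : (2 : F) ≠ 0) (h3 : (3 : F) ≠ 0)
    (s x y : A) : associator s x y + associator s y x =
      associator s (σ x) y + associator s y (σ x) := by
  have ht : x - σ x ∈ skewElements σ := by
    rw [mem_skewElements, map_sub, hA.invol, neg_sub]
  have := hA.associator_skew_right h2 h3 ht s y
  simp only [associator, mul_sub, sub_mul] at this ⊢
  linear_combination (norm := abel) this

/-! ### Exchange rules between V and L_s. -/

theorem vOp_skew_add (hA : IsStructurable σ) (h2 : (2 : F) ≠ 0) (h3 : (3 : F) ≠ 0)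
    {s : A} (hs : s ∈ skewElements σ) (x y : A) :
    vOp σ x y s + s * vOp σ y x 1 = skewForm σ (s * y) x := by
  have e1 := hA.associator_skew_left h2 h3 hs x (σ y)
  have e2 := hA.associator_skew_right h2 h3 hs x (σ y)
  have e3 := hA.associator_symm_conj h2 h3 s x (σ y)
  have e4 := hA.associator_symm_conj h2 h3 s (σ y) (σ x)
  rw [hA.invol] at e4
  simp only [skewForm, vOp_apply, hA.anti, mem_skewElements.1 hs, mul_add, mul_sub, one_mul,
    mul_one, mul_neg] at e1 e2 e3 e4 ⊢
  simp only [associator] at e1 e2 e3 e4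
  linear_combination (norm := abel) e3 + e4 - e1 + e2

/-- `V_{x,y} L_s + L_s V_{y,x} = L_{ψ(sy, x)}` for skew `s`. -/
theorem vOp_skew_mul (hA : IsStructurable σ) (h2 : (2 : F) ≠ 0) (h3 : (3 : F) ≠ 0)
    {s : A} (hs : s ∈ skewElements σ) (x y v : A) :
    vOp σ x y (s * v) + s * vOp σ y x v = skewForm σ (s * y) x * v := by
  rw [hA.vOp_skew_mul_aux h2 hs, hA.vOp_skew_add h2 h3 hs]

/-- `V_{sy,x} - V_{sx,y} = L_s L_{ψ(y,x)}` for skew `s`. -/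
theorem vOp_mul_left_sub (hA : IsStructurable σ) (h2 : (2 : F) ≠ 0) (h3 : (3 : F) ≠ 0)
    {s : A} (hs : s ∈ skewElements σ) (x y v : A) :
    vOp σ (s * y) x v - vOp σ (s * x) y v = s * (skewForm σ y x * v) := by
  -- Here v becomes the first index, since ψ(y,x)v = V_{y,v}x - V_{x,v}y.
  have e1 := hA.vOp_skew_mul h2 h3 hs v y x
  have e2 := hA.vOp_skew_mul h2 h3 hs v x y
  simp only [hA.skewForm_mul, mul_sub] at *
  linear_combination (norm := abel) -e1 + e2

theorem skewForm_vOp (hA : IsStructurable σ) (h2 : (2 : F) ≠ 0) (h3 : (3 : F) ≠ 0)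
    (x y z w : A) :
    skewForm σ (vOp σ x y z) w + skewForm σ z (vOp σ x y w) =
      skewForm σ (skewForm σ z w * y) x := by
  have h := hA.vOp_skewForm_mul x y z w 1
  rwa [hA.vOp_skew_mul h2 h3 (hA.skewForm_mem z w), mul_one, mul_one, eq_comm] at h

theorem vOp_add_right (_ : IsStructurable σ) (x y y' z : A) :
    vOp σ x (y + y') z = vOp σ x y z + vOp σ x y' z := by
  simp only [vOp_apply, map_add, mul_add, add_mul]; abel

theorem vOp_smul_right (_ : IsStructurable σ) (c : F) (x y z : A) :
    vOp σ x (c • y) z = c • vOp σ x y z := by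
  simp only [vOp_apply, map_smul, mul_smul_comm, smul_mul_assoc, smul_add, smul_sub]

theorem vOp_add_left (_ : IsStructurable σ) (x x' y z : A) :
    vOp σ (x + x') y z = vOp σ x y z + vOp σ x' y z := by
  simp only [vOp_apply, map_add, mul_add, add_mul]; abel

theorem vOp_smul_left (_ : IsStructurable σ) (c : F) (x y z : A) :
    vOp σ (c • x) y z = c • vOp σ x y z := by
  simp only [vOp_apply, map_smul, mul_smul_comm, smul_mul_assoc, smul_add, smul_sub]

theorem vOp_sub_right (hA : IsStructurable σ) (x y y' z : A) :
    vOp σ x (y - y') z = vOp σ x y z - vOp σ x y' z := by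
  rw [eq_sub_iff_add_eq, ← hA.vOp_add_right, sub_add_cancel]

theorem vOp_sub_left (hA : IsStructurable σ) (x x' y z : A) :
    vOp σ (x - x') y z = vOp σ x y z - vOp σ x' y z := by
  rw [eq_sub_iff_add_eq, ← hA.vOp_add_left, sub_add_cancel]

/-- `V_{x,sy} - V_{y,sx} = -L_{ψ(x,y)} L_s` for skew `s`. -/
theorem vOp_mul_right_sub (hA : IsStructurable σ) (h2 : (2 : F) ≠ 0) (h3 : (3 : F) ≠ 0)
    {s : A} (hs : s ∈ skewElements σ) (x y v : A) :
    vOp σ x (s * y) v - vOp σ y (s * x) v = -(skewForm σ x y * (s * v)) := by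
  -- For s = ψ(p,q) both sides become sums of V's. They match through four commutator identities
  -- whose left sides cancel in pairs by antisymmetry.
  have key (p q : A) : vOp σ x (skewForm σ p q * y) v - vOp σ y (skewForm σ p q * x) v =
      skewForm σ y x * (skewForm σ p q * v) := by
    rw [← hA.vOp_mul_left_sub h2 h3 (hA.skewForm_mem y x) q p]
    simp only [hA.skewForm_mul, hA.vOp_sub_right, hA.vOp_sub_left]
    linear_combination (norm := abel) hA.vOp_vOp y p x q v - hA.vOp_vOp y q x p v
      - hA.vOp_vOp x p y q v + hA.vOp_vOp x q y p v
  have h := key s 1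
  rw [hA.skewForm_one hs] at h
  simp only [smul_mul_assoc, mul_smul_comm, hA.vOp_smul_right, ← smul_sub] at h
  rw [smul_right_injective A h2 h, hA.skewForm_swap y x, neg_mul]

/-! ### Triple products with s in the middle. -/

/-- Taking v = 1 gives (JT1); taking x skew and y = 1 gives the special-module identity. -/
theorem mul_mul_skewForm_mul (hA : IsStructurable σ) (h2 : (2 : F) ≠ 0) (h3 : (3 : F) ≠ 0)
    {a s : A} (ha : a ∈ skewElements σ) (hs : s ∈ skewElements σ) (x y v : A) :
    a * (s * (skewForm σ x y * v)) + skewForm σ x y * (s * (a * v)) =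
      (skewForm σ (a * (s * x)) y + skewForm σ x (a * (s * y))) * v := by
  have e1 := hA.vOp_skew_mul h2 h3 ha y (s * x) v
  have e2 := hA.vOp_skew_mul h2 h3 ha x (s * y) v
  have e3 := hA.vOp_mul_right_sub h2 h3 hs x y (a * v)
  rw [← hA.vOp_mul_left_sub h2 h3 hs, hA.skewForm_swap x (a * (s * y)), add_mul, neg_mul, mul_sub]
  linear_combination (norm := abel) e1 - e2 + e3

theorem mul_skewForm_add (hA : IsStructurable σ) (h2 : (2 : F) ≠ 0) (h3 : (3 : F) ≠ 0)
    {a s : A} (ha : a ∈ skewElements σ) (hs : s ∈ skewElements σ) (x y : A) :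
    a * (s * skewForm σ x y) + skewForm σ x y * (s * a) =
      skewForm σ (a * (s * x)) y + skewForm σ x (a * (s * y)) := by
  simpa only [mul_one] using hA.mul_mul_skewForm_mul h2 h3 ha hs x y 1

theorem skew_triple_mul (hA : IsStructurable σ) (h2 : (2 : F) ≠ 0) (h3 : (3 : F) ≠ 0)
    {a s b : A} (ha : a ∈ skewElements σ) (hs : s ∈ skewElements σ) (hb : b ∈ skewElements σ)
    (v : A) :
    a * (s * (b * v)) + b * (s * (a * v)) = (a * (s * b) + b * (s * a)) * v := by
  have h := hA.mul_mul_skewForm_mul h2 h3 ha hs b 1 v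
  rw [← hA.mul_skewForm_add h2 h3 ha hs, hA.skewForm_one hb] at h
  simp only [smul_mul_assoc, mul_smul_comm, ← smul_add] at h
  exact smul_right_injective A h2 h

theorem skew_triple_mem (hA : IsStructurable σ) (h2 : (2 : F) ≠ 0) (h3 : (3 : F) ≠ 0)
    {a s b : A} (ha : a ∈ skewElements σ) (hs : s ∈ skewElements σ) (hb : b ∈ skewElements σ) :
    a * (s * b) + b * (s * a) ∈ skewElements σ := by
  have h := hA.mul_skewForm_add h2 h3 ha hs b 1
  rw [hA.skewForm_one hb] at h
  simp only [smul_mul_assoc, mul_smul_comm, ← smul_add] at h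
  rw [← Submodule.smul_mem_iff _ h2, h]
  exact add_mem (hA.skewForm_mem _ _) (hA.skewForm_mem _ _)

theorem mul_skewForm_mul_mul (hA : IsStructurable σ) (h2 : (2 : F) ≠ 0) (h3 : (3 : F) ≠ 0)
    {s : A} (hs : s ∈ skewElements σ) (x y v : A) :
    s * (skewForm σ x y * (s * v)) = -(skewForm σ (s * x) (s * y) * v) := by
  have e1 := hA.vOp_skew_mul h2 h3 hs (s * y) x v
  have e2 := hA.vOp_skew_mul h2 h3 hs (s * x) y v
  have e3 := hA.vOp_mul_left_sub h2 h3 hs y x (s * v)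
  have e4 := congrArg (s * ·) (hA.vOp_mul_right_sub h2 h3 hs x y v)
  rw [hA.skewForm_swap (s * y) (s * x), neg_mul] at e2
  simp only [mul_sub, mul_neg] at e4
  apply smul_right_injective A h2
  linear_combination (norm := module) -e1 + e2 - e3 + e4

/-- This turns -V_{z,V_{sy,x}(sw)} in the commutator identity into the middle term of (JT6). -/
theorem vOp_mul_mul (hA : IsStructurable σ) (h2 : (2 : F) ≠ 0) (h3 : (3 : F) ≠ 0)
    {s : A} (hs : s ∈ skewElements σ) (x y w : A) :
    vOp σ (s * y) x (s * w) = -(s * vOp σ y (s * x) w) := by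
  have e1 := hA.vOp_skew_mul h2 h3 hs (s * y) x w
  have e2 := congrArg (s * ·) (hA.vOp_mul_right_sub h2 h3 hs x y w)
  have e3 := hA.mul_skewForm_mul_mul h2 h3 hs x y w
  simp only [mul_sub, mul_neg] at e2
  linear_combination (norm := abel) e1 - e2 + e3

theorem mul_mul_vOp (hA : IsStructurable σ) (h2 : (2 : F) ≠ 0) (h3 : (3 : F) ≠ 0)
    {a s : A} (ha : a ∈ skewElements σ) (hs : s ∈ skewElements σ) (x y z : A) :
    a * (s * vOp σ x (s * y) z) = vOp σ (a * (s * x)) (s * y) z -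
      vOp σ x (s * (a * (s * y))) z + vOp σ x (s * y) (a * (s * z)) := by
  have e1 := congrArg (a * ·) (hA.vOp_skew_mul h2 h3 hs (s * y) x z)
  have e2 := hA.vOp_skew_mul h2 h3 ha x (s * y) (s * z)
  have e3 := hA.vOp_mul_left_sub h2 h3 ha (s * y) (s * x) z
  have e4 := hA.vOp_mul_right_sub h2 h3 hs (a * (s * y)) x z
  simp only [mul_add] at e1
  linear_combination (norm := abel) e1 - e2 - e3 - e4

/-- A skew element with bijective left multiplication has a skew inverse. -/
theorem exists_skew_inverse (hA : IsStructurable σ) (h2 : (2 : F) ≠ 0) (h3 : (3 : F) ≠ 0)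
    {s : A} (hs : s ∈ skewElements σ) (hbij : Function.Bijective (fun x : A => s * x)) :
    ∃ u ∈ skewElements σ, ∀ x, u * (s * x) = x := by
  obtain ⟨u, hu⟩ := hbij.2 1
  simp only at hu
  -- Flexibility turns the right inverse u of s into a two-sided one, after cancelling s in s(us) =
  -- (su)s.
  have flex : associator s u s = 0 := by
    have e1 := hA.associator_skew_left h2 h3 hs u s
    have e2 := hA.associator_skew_right h2 h3 hs u s
    have e3 : associator u s s = 0 := by
      apply smul_right_injective A h2
      linear_combination (norm := module) e2
    rw [e1, e3, neg_zero]
  have hus : u * s = 1 := by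
    apply hbij.1
    simp only
    rw [associator, sub_eq_zero, hu, one_mul] at flex
    rw [← flex, mul_one]
  have hu' : u ∈ skewElements σ := by
    rw [mem_skewElements]
    have e1 := congrArg σ hus
    rw [hA.anti, mem_skewElements.1 hs, hA.map_one] at e1
    apply hbij.1
    simp only
    rw [mul_neg, hu, ← e1, neg_mul, neg_neg]
  refine ⟨u, hu', fun x => hbij.1 (smul_right_injective A h2 ?_)⟩
  -- With u in the middle the identity reads 2s(u(sx)) = 2sx.
  have h := hA.skew_triple_mul h2 h3 hs hu' hs x
  rw [hus, mul_one, add_mul] at h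
  linear_combination (norm := module) h

end IsStructurable

/-! ### Assembly of the J-ternary algebra. -/

theorem proposition4p2 {F A : Type*} [Field F] (h2 : (2 : F) ≠ 0) (h3 : (3 : F) ≠ 0)
    [NonAssocRing A] [Module F A] [IsScalarTower F A A] [SMulCommClass F A A]
    (σ : A →ₗ[F] A) (hA : IsStructurable σ)
    (s : A) (hs : s ∈ skewElements σ) (hbij : Function.Bijective (fun x : A => s * x)) :
    ∃ (mul : skewElements σ →ₗ[F] skewElements σ →ₗ[F] skewElements σ)
      (act : skewElements σ →ₗ[F] A →ₗ[F] A)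
      (form : A →ₗ[F] A →ₗ[F] skewElements σ)
      (tri : A →ₗ[F] A →ₗ[F] A →ₗ[F] A),
      (∀ a b : skewElements σ,
        (mul a b : A) = (2⁻¹ : F) • ((a : A) * (s * (b : A)) + (b : A) * (s * (a : A)))) ∧
      (∀ (a : skewElements σ) (x : A), act a x = (a : A) * (s * x)) ∧
      (∀ x y : A, (form x y : A) = x * σ y - y * σ x) ∧
      (∀ x y z : A, tri x y z = -vOp σ x (s * y) z) ∧
      IsJTernary mul act form tri := by
  let mul : skewElements σ →ₗ[F] skewElements σ →ₗ[F] skewElements σ :=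
    LinearMap.mk₂ F (fun a b => ⟨(2⁻¹ : F) • ((a : A) * (s * (b : A)) + (b : A) * (s * (a : A))),
        Submodule.smul_mem _ _ (hA.skew_triple_mem h2 h3 a.2 hs b.2)⟩)
      (fun a a' b => Subtype.ext <| by
        simp only [Submodule.coe_add, mul_add, add_mul, smul_add]; abel)
      (fun c a b => Subtype.ext <| by
        simp only [Submodule.coe_smul, mul_smul_comm, smul_mul_assoc]; module)
      (fun a b b' => Subtype.ext <| by
        simp only [Submodule.coe_add, mul_add, add_mul, smul_add]; abel)
      (fun c a b => Subtype.ext <| by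
        simp only [Submodule.coe_smul, mul_smul_comm, smul_mul_assoc]; module)
  let act : skewElements σ →ₗ[F] A →ₗ[F] A :=
    LinearMap.mk₂ F (fun a x => (a : A) * (s * x))
      (fun a a' x => by simp only [Submodule.coe_add, add_mul])
      (fun c a x => by simp only [Submodule.coe_smul, smul_mul_assoc])
      (fun a x x' => by simp only [mul_add])
      (fun c a x => by simp only [mul_smul_comm])
  let form : A →ₗ[F] A →ₗ[F] skewElements σ :=
    LinearMap.mk₂ F (fun x y => ⟨skewForm σ x y, hA.skewForm_mem x y⟩)
      (fun x x' y => Subtype.ext <| by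
        simp only [skewForm, Submodule.coe_add, map_add, mul_add, add_mul]; abel)
      (fun c x y => Subtype.ext <| by
        simp only [skewForm, Submodule.coe_smul, map_smul, mul_smul_comm, smul_mul_assoc, smul_sub])
      (fun x y y' => Subtype.ext <| by
        simp only [skewForm, Submodule.coe_add, map_add, mul_add, add_mul]; abel)
      (fun c x y => Subtype.ext <| by
        simp only [skewForm, Submodule.coe_smul, map_smul, mul_smul_comm, smul_mul_assoc, smul_sub])
  let tri : A →ₗ[F] A →ₗ[F] A →ₗ[F] A :=
    LinearMap.mk₂ F (fun x y => -vOp σ x (s * y))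
      (fun x x' y => LinearMap.ext fun z => by
        simp only [LinearMap.neg_apply, LinearMap.add_apply, hA.vOp_add_left]; abel)
      (fun c x y => LinearMap.ext fun z => by
        simp only [LinearMap.neg_apply, LinearMap.smul_apply, hA.vOp_smul_left, smul_neg])
      (fun x y y' => LinearMap.ext fun z => by
        simp only [LinearMap.neg_apply, LinearMap.add_apply, mul_add, hA.vOp_add_right]; abel)
      (fun c x y => LinearMap.ext fun z => by
        simp only [LinearMap.neg_apply, LinearMap.smul_apply, mul_smul_comm, hA.vOp_smul_right,
          smul_neg])
  have hmul (a b : skewElements σ) :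
      (mul a b : A) = (2⁻¹ : F) • ((a : A) * (s * (b : A)) + (b : A) * (s * (a : A))) := rfl
  have hact (a : skewElements σ) (x : A) : act a x = (a : A) * (s * x) := rfl
  have hform (x y : A) : (form x y : A) = skewForm σ x y := rfl
  have htri (x y z : A) : tri x y z = -vOp σ x (s * y) z := rfl
  have act_mul (a b : skewElements σ) (x : A) :
      act (mul a b) x = (2⁻¹ : F) • (act a (act b x) + act b (act a x)) := by
    simp only [hact, hmul, smul_mul_assoc]
    rw [hA.skew_triple_mul h2 h3 a.2 hs b.2]
  -- Evaluating at u with su = 1 recovers a.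
  have act_injective : Function.Injective act := fun a b h => by
    obtain ⟨u, hu⟩ := hbij.2 1
    have := LinearMap.congr_fun h u
    rw [hact, hact, show s * u = 1 from hu, mul_one, mul_one] at this
    exact Subtype.ext this
  refine ⟨mul, act, form, tri, hmul, hact, hform, htri, ?_⟩
  constructor
  · obtain ⟨e, he, hes⟩ := hA.exists_skew_inverse h2 h3 hs hbij
    have act_one (x : A) : act ⟨e, he⟩ x = x := hes x
    have act_mul' (a b : skewElements σ) :
        act (mul a b) = (2⁻¹ : F) • (act a ∘ₗ act b + act b ∘ₗ act a) :=
      LinearMap.ext fun x => act_mul a b x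
    refine ⟨⟨e, he⟩, ⟨fun a b => Subtype.ext ?_, fun a b => act_injective ?_,
      fun a => act_injective <| LinearMap.ext fun x => ?_⟩, act_mul, act_one⟩
    · rw [hmul, hmul, add_comm]
    · have h := symm_mul_jordan (R := Module.End F A) (act a) (act b)
      simp only [act_mul', ← Module.End.mul_eq_comp]
      simp only [smul_mul_assoc, mul_smul_comm, smul_add, mul_add, add_mul] at h ⊢
      -- Each side of the Jordan identity contains three products, each contributing a factor 1/2.
      linear_combination (norm := module) ((2⁻¹ : F) ^ 3) • h
    · rw [act_mul, act_one, act_one, smul_add, ← add_smul, ← two_mul, mul_inv_cancel₀ h2, one_smul]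
  · exact fun x y => Subtype.ext (hA.skewForm_swap x y)
  · intro a x y
    refine Subtype.ext ?_
    simp only [hmul, hact, hform, Submodule.coe_smul, Submodule.coe_add]
    rw [hA.mul_skewForm_add h2 h3 a.2 hs]
  · intro a x y z
    simp only [hact, htri, mul_neg]
    linear_combination (norm := abel) -hA.mul_mul_vOp h2 h3 a.2 hs x y z
  · intro x y z
    rw [htri, htri, hact, hform, hA.skewForm_mul]
    abel
  · intro x y z
    rw [htri, htri, hact, hform]
    linear_combination (norm := abel) -hA.vOp_mul_right_sub h2 h3 hs x y z
  · intro x y z w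
    refine Subtype.ext ?_
    have h := hA.skewForm_vOp h2 h3 x (s * y) z w
    rw [hA.skewForm_swap (skewForm σ z w * (s * y)) x] at h
    simp only [Submodule.coe_add, htri, hact, map_neg, LinearMap.neg_apply, Submodule.coe_neg,
      hform]
    linear_combination (norm := abel) -h
  · intro x y z w v
    have h := hA.vOp_vOp x (s * y) z (s * w) v
    have e : vOp σ z (-(s * vOp σ y (s * x) w)) v = -vOp σ z (s * vOp σ y (s * x) w) v := by
      rw [← neg_one_smul F, hA.vOp_smul_right, neg_one_smul]
    rw [hA.vOp_mul_mul h2 h3 hs, e] at h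
    simp only [htri, map_neg, LinearMap.neg_apply]
    linear_combination (norm := abel) h
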